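/- **Theorem 4.3 (Change of Variable Theorem).** Let $K\in\{\mathbb R,\mathbb C\}$, let $(T,d)$ be a compact metric space with Borel $\sigma$-algebra $\mathcal B_T$, let $X$ be a Hilbert space over $K$ with scalar product $(\cdot,\cdot)$ (linear in the first variable) and Borel $\sigma$-algebra $\mathcal B_X$, and let $(\Theta,\Sigma,W)$ be a measure space. Let $\omega:T\times\Theta\to T$ be $(\mathcal B_T\otimes\Sigma,\mathcal B_T)$-measurable and $R:X\times\Theta\to X$ be $(\mathcal B_X\otimes\Sigma,\mathcal B_X)$-measurable; write $\omega_\theta=\omega(\cdot,\theta)$ and $R_\theta=R(\cdot,\theta)$. Assume that every $\omega_\theta$ is Lipschitz, with Lipschitz constant $r_\theta$; that every $R_\theta$ is a continuous linear operator on $X$; that $\theta\mapsto\|R_\theta\|$ is measurable; that for every $x\in X$ the function $\theta\mapsto R_\theta(x)$ is $W$-almost everywhere a limit of a sequence of $\Sigma$-measurable functions with finitely many values (this is automatic if $X$ is separable); and that $$\int_\Theta\|R_\theta\|\,(1+r_\theta)\,dW(\theta)<\infty .$$ Let $C(T,X)$ be the space of continuous functions $T\to X$ with the supremum norm and $C(T,X)'$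 its dual. Let $H_C:C(T,X)\to C(T,X)$ be the continuous linear operator given by the Bochner integral $H_C(f)(t)=\int_\Theta R_\theta(f(\omega_\theta(t)))\,dW(\theta)$, with adjoint $H_C'(y)=y\circ H_C$ for $y\in C(T,X)'$. For a Banach space $E$ let $cabv(T,E)$ be the space of $\sigma$-additive measures $m:\mathcal B_T\to E$ of finite total variation, with norm $\|m\|=|m|(T)$. For $m\in cabv(T,X)$ the sesquilinear uniform integral of a simple function is $\int\sum_i 1_{A_i}x_i\,dm=\sum_i(x_i,m(A_i))$, where $(A_i)$ is a finite Borel partition of $T$, and for a uniform limit $f$ of simple functions $f_n$ it is $\int f\,dm=\lim_n\int f_n\,dm$. Let $X'$ be the dual of $X$. For $m'\in cabv(T,X')$ the linear integral $\int^* f\,dm'$ is defined in the same way from $\int^*\sum_i1_{A_i}x_i\,dm'=\sum_i m'(A_i)(x_i)$. For $m\in cabv(T,X)$ let $P\circ m\in cabv(T,X')$, where $P:X\to X'$, $P(y)=(\cdot,y)$, and let $\Phi(m)\in C(T,X)'$ be the functional $\Phi(m)(f)=\int^* f\,d(P\circ m)$. Then $\Phi:cabv(T,X)\to C(T,X)'$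 is an antilinear isometric bijection, and the operator $\mathcal H=\Phi^{-1}\circ H_C'\circ\Phi$ on $cabv(T,X)$ satisfies $$\int f\,d\mathcal H(\nu)=\int H_C(f)\,d\nu\qquad\text{for every } f\in C(T,X)\text{ and every }\nu\in cabv(T,X).$$ -/

import Mathlib

open MeasureTheory Filter Topology Set
open scoped ENNReal NNReal ComplexConjugate

set_option linter.unusedSectionVars false

noncomputable section

namespace VectorMeasureOperator

/-! ### Vector measures of bounded variation -/

/-- `cabv K T E`: the countably additive `E`-valued measures on the Borel sets of `T` that have
finite total variation. -/
def cabv (K T E : Type*) [RCLike K] [MeasurableSpace T] [NormedAddCommGroup E] [NormedSpace K E] :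
    Submodule K (VectorMeasure T E) where
  carrier := {μ | μ.variation univ < ∞}
  zero_mem' := by simp
  add_mem' := by
    intro μ ν hμ hν
    exact lt_of_le_of_lt (VectorMeasure.variation_add_le univ) (by
      simpa using ENNReal.add_lt_top.2 ⟨hμ, hν⟩)
  smul_mem' := by
    intro c μ hμ
    change (c • μ).variation univ < ∞
    rw [VectorMeasure.variation_smul, Measure.smul_apply]
    exact ENNReal.mul_lt_top ENNReal.coe_lt_top hμ

/-- The variational norm `‖μ‖ = |μ|(T)`. -/
def varNorm {T E : Type*} [MeasurableSpace T] [NormedAddCommGroup E]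
    (μ : VectorMeasure T E) : ℝ :=
  (μ.variation univ).toReal

/-! ### The uniform integral

Both the sesquilinear integral and the classical linear integral are instances of one
construction, in which the values of the function and of the measure are paired by `p`. -/

section UniformIntegral

variable {K T X Y : Type*} [RCLike K] [MeasurableSpace T]
  [NormedAddCommGroup X] [NormedAddCommGroup Y]

/-- The integral `∑ p(xᵢ, ν(Aᵢ))` of the simple function `∑ 1_{Aᵢ} xᵢ`. -/
def simpleIntegral (p : X → Y → K) (s : SimpleFunc T X) (ν : VectorMeasure T Y) : K :=
  ∑ x ∈ s.range, p x (ν (s ⁻¹' {x}))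

/-- `I` is the uniform integral of `f`: `f` is totally measurable, that is, a uniform limit of
simple functions, and for every sequence of simple functions that converges uniformly to `f` the
integrals of the simple functions converge to `I`. -/
def IsUniformIntegral (p : X → Y → K) (f : T → X) (ν : VectorMeasure T Y) (I : K) : Prop :=
  (∃ s : ℕ → SimpleFunc T X, TendstoUniformly (fun n t => s n t) f atTop) ∧
  ∀ s : ℕ → SimpleFunc T X, TendstoUniformly (fun n t => s n t) f atTop →
    Tendsto (fun n => simpleIntegral p (s n) ν) atTop (𝓝 I)

open scoped Classical in
/-- The uniform integral of `f`. The value `0` is used if it does not exist; it does exist for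
every continuous `f` on a compact space, see `isUniformIntegral_uniformIntegral`. -/
def uniformIntegral (p : X → Y → K) (f : T → X) (ν : VectorMeasure T Y) : K :=
  if h : ∃ I, IsUniformIntegral p f ν I then h.choose else 0

lemma IsUniformIntegral.eq {p : X → Y → K} {f : T → X} {ν : VectorMeasure T Y} {I : K}
    (h : IsUniformIntegral p f ν I) : uniformIntegral p f ν = I := by
  have h' : ∃ I, IsUniformIntegral p f ν I := ⟨I, h⟩
  obtain ⟨s, hs⟩ := h.1
  rw [uniformIntegral, dif_pos h']
  exact tendsto_nhds_unique (h'.choose_spec.2 s hs) (h.2 s hs)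

/-- The pairings used below: biadditive, with `|p(x, y)| ≤ ‖x‖ ‖y‖`. -/
structure IsPairing (p : X → Y → K) : Prop where
  add_left : ∀ x x' y, p (x + x') y = p x y + p x' y
  add_right : ∀ x y y', p x (y + y') = p x y + p x y'
  bound : ∀ x y, ‖p x y‖ ≤ ‖x‖ * ‖y‖

variable {p : X → Y → K}

lemma simpleIntegral_map (hp : IsPairing p) {Z : Type*} (s : SimpleFunc T Z) (g : Z → X)
    (ν : VectorMeasure T Y) :
    simpleIntegral p (s.map g) ν = ∑ z ∈ s.range, p (g z) (ν (s ⁻¹' {z})) := by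
  classical
  rw [simpleIntegral, SimpleFunc.range_map]
  refine Finset.sum_image' _ fun z hz => ?_
  have h1 : (s.map g) ⁻¹' {g z} = ⋃ y ∈ s.range.filter (fun y => g y = g z), s ⁻¹' {y} := by
    rw [SimpleFunc.map_preimage_singleton, ← Finset.set_biUnion_preimage_singleton]
  rw [h1, VectorMeasure.of_biUnion_finset]
  · let q : Y →+ K := AddMonoidHom.mk' (p (g z)) (hp.add_right (g z))
    have h2 := map_sum q (fun y => ν (s ⁻¹' {y})) (s.range.filter (fun y => g y = g z))
    refine h2.trans (Finset.sum_congr rfl fun y hy => ?_)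
    rw [(Finset.mem_filter.1 hy).2]
    rfl
  · intro a _ b _ hab
    exact Disjoint.preimage _ (by simpa using hab)
  · exact fun b _ => s.measurableSet_fiber b

lemma simpleIntegral_add (hp : IsPairing p) (s s' : SimpleFunc T X) (ν : VectorMeasure T Y) :
    simpleIntegral p (s + s') ν = simpleIntegral p s ν + simpleIntegral p s' ν := by
  have h := simpleIntegral_map hp (s.pair s') (fun z => z.1 + z.2) ν
  have h1 := simpleIntegral_map hp (s.pair s') Prod.fst ν
  have h2 := simpleIntegral_map hp (s.pair s') Prod.snd ν
  rw [SimpleFunc.map_fst_pair] at h1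
  rw [SimpleFunc.map_snd_pair] at h2
  have e : s + s' = (s.pair s').map (fun z => z.1 + z.2) := rfl
  rw [e, h, h1, h2, ← Finset.sum_add_distrib]
  simp only [hp.add_left]

lemma norm_simpleIntegral_le (hp : IsPairing p) (s : SimpleFunc T X) (ν : VectorMeasure T Y)
    (hν : ν.variation univ < ∞) {C : ℝ} (hC : ∀ t, ‖s t‖ ≤ C) :
    ‖simpleIntegral p s ν‖ ≤ C * varNorm ν := by
  have hfin : ∀ A, ν.variation A ≠ ∞ := fun A =>
    (lt_of_le_of_lt (measure_mono (subset_univ A)) hν).ne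
  calc ‖simpleIntegral p s ν‖ ≤ ∑ x ∈ s.range, C * (ν.variation (s ⁻¹' {x})).toReal := by
        refine norm_sum_le_of_le _ fun x hx => (hp.bound _ _).trans ?_
        obtain ⟨t, rfl⟩ := SimpleFunc.mem_range.1 hx
        exact mul_le_mul (hC t) (VectorMeasure.norm_measure_le_variation (hfin _))
          (norm_nonneg _) ((norm_nonneg _).trans (hC t))
    _ = C * varNorm ν := by
        rw [← Finset.mul_sum, ← ENNReal.toReal_sum (fun x _ => hfin _),
          SimpleFunc.sum_range_measure_preimage_singleton, varNorm]

lemma norm_simpleIntegral_sub_le (hp : IsPairing p) (s s' : SimpleFunc T X)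
    (ν : VectorMeasure T Y) (hν : ν.variation univ < ∞) {C : ℝ} (hC : ∀ t, ‖s t - s' t‖ ≤ C) :
    ‖simpleIntegral p s ν - simpleIntegral p s' ν‖ ≤ C * varNorm ν := by
  have h := simpleIntegral_add hp (s - s') s' ν
  have e : s - s' + s' = s := by ext t; simp
  rw [e] at h
  rw [h, add_sub_cancel_right]
  exact norm_simpleIntegral_le hp _ ν hν hC

/-- A continuous function on a compact metric space is totally measurable. -/
lemma exists_tendstoUniformly_simpleFunc {T : Type*} [MetricSpace T] [CompactSpace T]
    [MeasurableSpace T] [BorelSpace T] {f : T → X} (hf : Continuous f) :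
    ∃ s : ℕ → SimpleFunc T X, TendstoUniformly (fun n t => s n t) f atTop := by
  rcases isEmpty_or_nonempty T with hT | hT
  · exact ⟨fun _ => 0, Metric.tendstoUniformly_iff.2 fun ε _ =>
      Eventually.of_forall fun n t => (hT.false t).elim⟩
  · let e := TopologicalSpace.denseSeq T
    refine ⟨fun n => (SimpleFunc.nearestPt e n).map f, Metric.tendstoUniformly_iff.2 ?_⟩
    intro ε hε
    obtain ⟨δ, hδ, h⟩ := Metric.uniformContinuous_iff.1
      (CompactSpace.uniformContinuous_of_continuous hf) ε hε
    obtain ⟨F, hF⟩ := isCompact_univ.elim_finite_subcover (fun k => Metric.ball (e k) δ)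
      (fun _ => Metric.isOpen_ball) (by
        intro t _
        obtain ⟨k, hk⟩ := (TopologicalSpace.denseRange_denseSeq T).exists_dist_lt t hδ
        exact mem_iUnion.2 ⟨k, hk⟩)
    filter_upwards [eventually_ge_atTop (F.sup id)] with n hn t
    obtain ⟨k, hk⟩ := mem_iUnion.1 (hF (mem_univ t))
    obtain ⟨hkF, hk⟩ := mem_iUnion.1 hk
    rw [dist_comm]
    refine h (lt_of_le_of_lt ?_ (Metric.mem_ball'.1 hk))
    have := SimpleFunc.edist_nearestPt_le e t ((Finset.le_sup (f := id) hkF).trans hn)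
    rw [edist_dist, edist_dist] at this
    exact (ENNReal.ofReal_le_ofReal_iff dist_nonneg).1 this

/-- The uniform integral of a continuous function on a compact metric space exists. -/
lemma isUniformIntegral_uniformIntegral {T : Type*} [MetricSpace T] [CompactSpace T]
    [MeasurableSpace T] [BorelSpace T] (hp : IsPairing p) {f : T → X} (hf : Continuous f)
    (ν : VectorMeasure T Y) (hν : ν.variation univ < ∞) :
    IsUniformIntegral p f ν (uniformIntegral p f ν) := by
  have key : ∀ u s : ℕ → SimpleFunc T X, TendstoUniformly (fun n t => u n t) f atTop →
      TendstoUniformly (fun n t => s n t) f atTop → ∀ ε > 0, ∃ N, ∀ m ≥ N, ∀ n ≥ N,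
        dist (simpleIntegral p (u m) ν) (simpleIntegral p (s n) ν) < ε := by
    intro u s hu hs ε hε
    have hV : 0 ≤ varNorm ν := ENNReal.toReal_nonneg
    have hη : 0 < ε / (2 * (varNorm ν + 1)) := by positivity
    obtain ⟨N, hN⟩ := eventually_atTop.1
      ((Metric.tendstoUniformly_iff.1 hu _ hη).and (Metric.tendstoUniformly_iff.1 hs _ hη))
    refine ⟨N, fun m hm n hn => ?_⟩
    rw [dist_eq_norm]
    refine lt_of_le_of_lt (norm_simpleIntegral_sub_le hp _ _ ν hν
      (C := ε / (2 * (varNorm ν + 1)) + ε / (2 * (varNorm ν + 1))) fun t => ?_) ?_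
    · rw [← dist_eq_norm]
      refine (dist_triangle_left _ _ (f t)).trans (add_le_add ?_ ?_)
      · exact ((hN m hm).1 t).le
      · exact ((hN n hn).2 t).le
    · have : ε / (2 * (varNorm ν + 1)) + ε / (2 * (varNorm ν + 1)) = ε / (varNorm ν + 1) := by
        field_simp
        ring
      rw [this, div_mul_eq_mul_div, div_lt_iff₀ (by positivity)]
      nlinarith
  obtain ⟨u, hu⟩ := exists_tendstoUniformly_simpleFunc hf
  have hc : CauchySeq fun n => simpleIntegral p (u n) ν :=
    Metric.cauchySeq_iff.2 fun ε hε => key u u hu hu ε hε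
  obtain ⟨I, hI⟩ := cauchySeq_tendsto_of_complete hc
  have hmain : IsUniformIntegral p f ν I := by
    refine ⟨⟨u, hu⟩, fun s hs => hI.congr_dist ?_⟩
    refine Metric.tendsto_atTop.2 fun ε hε => ?_
    obtain ⟨N, hN⟩ := key u s hu hs ε hε
    refine ⟨N, fun n hn => ?_⟩
    rw [Real.dist_0_eq_abs, abs_of_nonneg dist_nonneg]
    exact hN n hn n hn
  rwa [hmain.eq]

end UniformIntegral

section Operators

variable {K T X : Type*} [RCLike K] [MetricSpace T] [CompactSpace T] [MeasurableSpace T]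
  [BorelSpace T] [NormedAddCommGroup X] [InnerProductSpace K X] [CompleteSpace X]

/-- The sesquilinear uniform integral `∫ f dm`, built on `(x, y)`, the scalar product of `X`. With
Mathlib's convention `inner K y x` is linear in `x` and antilinear in `y`. -/
def sesqIntegral (K : Type*) {T X : Type*} [RCLike K] [MeasurableSpace T]
    [NormedAddCommGroup X] [InnerProductSpace K X] (f : T → X) (m : VectorMeasure T X) : K :=
  uniformIntegral (fun x y => inner K y x) f m

/-- The classical linear integral `∫* f dm'` with respect to a measure with values in the dual. -/
def linIntegral {K T X : Type*} [RCLike K] [MeasurableSpace T]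
    [NormedAddCommGroup X] [NormedSpace K X] (f : T → X)
    (m' : VectorMeasure T (X →L[K] K)) : K :=
  uniformIntegral (fun x L => L x) f m'

lemma isPairing_inner : IsPairing (fun x y : X => inner K y x) where
  add_left x x' y := inner_add_right _ _ _
  add_right x y y' := inner_add_left _ _ _
  bound x y := by rw [mul_comm]; exact norm_inner_le_norm _ _

lemma isPairing_apply : IsPairing (fun (x : X) (L : X →L[K] K) => L x) where
  add_left x x' L := map_add L x x'
  add_right _ _ _ := rfl
  bound x L := by rw [mul_comm]; exact L.le_opNorm x

/-- `Γ(m')` is the continuous linear functional `f ↦ ∫* f dm'` on `C(T, X)`. -/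
def Gamma (m' : cabv K T (X →L[K] K)) : C(T, X) →L[K] K :=
  LinearMap.mkContinuous
    { toFun := fun f => linIntegral f m'.1
      map_add' := by
        intro f g
        have hf := isUniformIntegral_uniformIntegral (isPairing_apply (K := K)) f.continuous
          m'.1 m'.2
        have hg := isUniformIntegral_uniformIntegral (isPairing_apply (K := K)) g.continuous
          m'.1 m'.2
        have hfg := isUniformIntegral_uniformIntegral (isPairing_apply (K := K))
          (f + g).continuous m'.1 m'.2
        obtain ⟨s, hs⟩ := hf.1
        obtain ⟨u, hu⟩ := hg.1
        have h := hfg.2 (fun n => s n + u n) (hs.add hu)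
        simp only [simpleIntegral_add isPairing_apply] at h
        exact tendsto_nhds_unique h ((hf.2 s hs).add (hg.2 u hu))
      map_smul' := by
        intro c f
        have hf := isUniformIntegral_uniformIntegral (isPairing_apply (K := K)) f.continuous
          m'.1 m'.2
        have hcf := isUniformIntegral_uniformIntegral (isPairing_apply (K := K))
          (c • f).continuous m'.1 m'.2
        obtain ⟨s, hs⟩ := hf.1
        have h := hcf.2 (fun n => (s n).map (c • ·))
          ((uniformContinuous_const_smul c).comp_tendstoUniformly hs)
        simp only [simpleIntegral_map isPairing_apply, map_smul, ← Finset.smul_sum] at h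
        exact tendsto_nhds_unique h ((hf.2 s hs).const_smul c) }
    (varNorm m'.1) (by
      intro f
      have hf := isUniformIntegral_uniformIntegral (isPairing_apply (K := K)) f.continuous
        m'.1 m'.2
      obtain ⟨s, hs⟩ := hf.1
      have hV : 0 ≤ varNorm m'.1 := ENNReal.toReal_nonneg
      refine le_of_forall_pos_le_add fun ε hε => ?_
      have hη : 0 < ε / (varNorm m'.1 + 1) := by positivity
      refine le_of_tendsto (hf.2 s hs).norm ?_
      filter_upwards [Metric.tendstoUniformly_iff.1 hs _ hη] with n hn
      refine (norm_simpleIntegral_le isPairing_apply (s n) m'.1 m'.2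
        (C := ‖f‖ + ε / (varNorm m'.1 + 1)) fun t => ?_).trans ?_
      · have h1 := norm_sub_norm_le (s n t) (f t)
        have h2 := hn t
        rw [dist_comm, dist_eq_norm] at h2
        linarith [f.norm_coe_le_norm t]
      · have : ε / (varNorm m'.1 + 1) * varNorm m'.1 ≤ ε := by
          rw [div_mul_eq_mul_div, div_le_iff₀ (by positivity)]
          nlinarith
        rw [add_mul, mul_comm ‖f‖]
        linarith)

/-- The Riesz–Fréchet isomorphism `P : X → X'`, `P(y)(x) = (x, y)`, as an additive map. -/
def rieszP (K X : Type*) [RCLike K] [NormedAddCommGroup X] [InnerProductSpace K X]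
    [CompleteSpace X] : X →+ (X →L[K] K) :=
  AddMonoidHom.mk' (fun y => InnerProductSpace.toDual K X y) (map_add (InnerProductSpace.toDual K X))

lemma continuous_rieszP : Continuous (rieszP K X) :=
  (InnerProductSpace.toDual K X).continuous

/-- `Ω(m) = P ∘ m`. -/
def Omega (m : cabv K T X) : cabv K T (X →L[K] K) :=
  ⟨m.1.mapRange (rieszP K X) continuous_rieszP, by
    have hm : m.1.variation univ < ∞ := m.2
    refine lt_of_le_of_lt ?_ hm
    refine VectorMeasure.variation_le_of_forall_enorm_le (fun A _ => ?_) univ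
    refine le_trans (le_of_eq ?_) (VectorMeasure.enorm_measure_le_variation m.1 A)
    exact (InnerProductSpace.toDual K X).toLinearIsometry.enorm_map (m.1 A)⟩

/-- The identification `Φ = Γ ∘ Ω` of `cabv(T, X)` with the dual of `C(T, X)`. -/
def Phi (m : cabv K T X) : C(T, X) →L[K] K :=
  Gamma (Omega m)

/-! ### The operators on functions and on measures -/

/-- The Lipschitz constant `sup { d(g x, g y) / d(x, y) | x ≠ y }`. -/
def lipConst {T : Type*} [MetricSpace T] (g : T → T) : ℝ≥0∞ :=
  ⨆ (x : T) (y : T) (_ : x ≠ y), edist (g x) (g y) / edist x y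

/-- The data of the framework: an index measure space `(Θ, Σ, W)`, Lipschitz maps `ω_θ` of `T` and
continuous linear operators `R_θ` of `X`. The field `aestronglyMeasurable_R` says that the maps
`θ ↦ R_θ x` are measurable in the sense of the Bochner integral; for separable `X` it follows from
`measurable_R`. -/
structure Framework (K T X : Type*) {Θ : Type*} [RCLike K] [MetricSpace T] [MeasurableSpace T]
    [NormedAddCommGroup X] [InnerProductSpace K X] [MeasurableSpace X] [MeasurableSpace Θ]
    (W : Measure Θ) where
  ω : Θ → T → T
  R : Θ → X →L[K] X
  measurable_ω : Measurable fun q : T × Θ => ω q.2 q.1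
  measurable_R : Measurable fun q : X × Θ => R q.2 q.1
  aestronglyMeasurable_R : ∀ x, AEStronglyMeasurable (fun θ => R θ x) W
  lipConst_lt_top : ∀ θ, lipConst (ω θ) < ∞
  measurable_norm_R : Measurable fun θ => ‖R θ‖
  lintegral_lt_top : ∫⁻ θ, ‖R θ‖ₑ * (1 + lipConst (ω θ)) ∂W < ∞

namespace Framework

variable {Θ : Type*} [MeasurableSpace X] [MeasurableSpace Θ] {W : Measure Θ}
  (S : Framework K T X W)

lemma continuous_ω (θ : Θ) : Continuous (S.ω θ) := by
  have h : LipschitzWith (lipConst (S.ω θ)).toNNReal (S.ω θ) := by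
    intro x y
    rw [ENNReal.coe_toNNReal (S.lipConst_lt_top θ).ne]
    rcases eq_or_ne x y with rfl | hxy
    · simp
    · refine (ENNReal.div_le_iff (edist_pos.2 hxy).ne' (edist_ne_top x y)).1 ?_
      exact le_iSup_of_le x (le_iSup_of_le y (le_iSup_of_le hxy le_rfl))
  exact h.continuous

lemma integrable_norm_R : Integrable (fun θ => ‖S.R θ‖) W := by
  refine ⟨S.measurable_norm_R.aestronglyMeasurable, lt_of_le_of_lt ?_ S.lintegral_lt_top⟩
  refine lintegral_mono fun θ => ?_
  rw [enorm_norm]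
  exact le_mul_of_one_le_right' (self_le_add_right _ _)

lemma aestronglyMeasurable_comp (f : C(T, X)) (t : T) :
    AEStronglyMeasurable (fun θ => S.R θ (f (S.ω θ t))) W := by
  have hω : StronglyMeasurable fun θ => f (S.ω θ t) :=
    f.continuous.comp_stronglyMeasurable
      (S.measurable_ω.comp (measurable_const.prodMk measurable_id)).stronglyMeasurable
  refine aestronglyMeasurable_of_tendsto_ae atTop (f := fun n θ => S.R θ (hω.approx n θ)) ?_ ?_
  · intro n
    have : (fun θ => S.R θ (hω.approx n θ)) = fun θ => ∑ x ∈ (hω.approx n).range,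
        (hω.approx n ⁻¹' {x}).indicator (fun θ => S.R θ x) θ := by
      funext θ
      rw [Finset.sum_eq_single (hω.approx n θ)]
      · simp
      · intro x _ hx
        simp [Set.indicator, hx.symm]
      · intro h
        exact (h (SimpleFunc.mem_range_self _ θ)).elim
    rw [this]
    exact Finset.aestronglyMeasurable_fun_sum _ fun x _ =>
      (S.aestronglyMeasurable_R x).indicator (SimpleFunc.measurableSet_fiber _ x)
  · exact Eventually.of_forall fun θ =>
      ((S.R θ).continuous.tendsto _).comp (hω.tendsto_approx θ)

lemma norm_comp_le (f : C(T, X)) (t : T) (θ : Θ) :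
    ‖S.R θ (f (S.ω θ t))‖ ≤ ‖S.R θ‖ * ‖f‖ :=
  ((S.R θ).le_opNorm _).trans (mul_le_mul_of_nonneg_left (f.norm_coe_le_norm _) (norm_nonneg _))

lemma integrable_comp (f : C(T, X)) (t : T) :
    Integrable (fun θ => S.R θ (f (S.ω θ t))) W :=
  (S.integrable_norm_R.mul_const ‖f‖).mono' (S.aestronglyMeasurable_comp f t)
    (Eventually.of_forall (S.norm_comp_le f t))

/-- The operator `H_C` on `C(T, X)`, `H_C(f)(t) = ∫ (R_θ ∘ f ∘ ω_θ)(t) dW(θ)` (Bochner integral). -/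
def HC : C(T, X) →L[K] C(T, X) :=
  letI : NormedSpace ℝ X := NormedSpace.restrictScalars ℝ K X
  LinearMap.mkContinuous
    { toFun := fun f =>
        { toFun := fun t => ∫ θ, S.R θ (f (S.ω θ t)) ∂W
          continuous_toFun := continuous_of_dominated (S.aestronglyMeasurable_comp f)
            (fun t => Eventually.of_forall (S.norm_comp_le f t))
            (S.integrable_norm_R.mul_const ‖f‖)
            (Eventually.of_forall fun θ =>
              (S.R θ).continuous.comp (f.continuous.comp (S.continuous_ω θ))) }
      map_add' := by
        intro f g
        ext t
        simp only [ContinuousMap.coe_mk, ContinuousMap.add_apply, map_add]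
        exact integral_add (S.integrable_comp f t) (S.integrable_comp g t)
      map_smul' := by
        intro c f
        ext t
        simp only [ContinuousMap.coe_mk, ContinuousMap.smul_apply, map_smul, RingHom.id_apply]
        exact integral_smul c _ }
    (∫ θ, ‖S.R θ‖ ∂W) (by
      intro f
      refine (ContinuousMap.norm_le _ (by positivity)).2 fun t => ?_
      refine (norm_integral_le_of_norm_le (S.integrable_norm_R.mul_const ‖f‖)
        (Eventually.of_forall (S.norm_comp_le f t))).trans (le_of_eq ?_)
      exact integral_mul_const _ _)

/-- The adjoint `H_C'(y) = y ∘ H_C`. -/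
def HCadjoint (y : C(T, X) →L[K] K) : C(T, X) →L[K] K :=
  y.comp S.HC

/-- The measure operator `Φ⁻¹ ∘ H_C' ∘ Φ` on `cabv(T, X)`. Here `Φ⁻¹` is `Function.invFun Φ`, which
is the inverse of `Φ` once `Φ` is bijective. -/
def measureOp (ν : cabv K T X) : cabv K T X :=
  Function.invFun Phi (S.HCadjoint (Phi ν))

end Framework

end Operators

end VectorMeasureOperator

end

open VectorMeasureOperator

/-!
The heart of the theorem is the representation of the dual of `C(T, X)` by vector measures.

*Isometry.* For a simple function `s` and a uniform integral `I` of `f` against `ν` one has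
`|∫ s dν - I| ≤ ∫ ‖s - f‖ d|ν|` (`IsUniformIntegral.enorm_simpleIntegral_sub_le`). With `s = 0` this
gives `‖Φ(m)‖ ≤ |m|(T)`. Conversely, unit vectors in the directions of the values of `m` on a fine
partition form a simple function of norm at most `1` whose integral nearly reaches `|m|(T)`
(`exists_simpleFunc_lt_enorm_simpleIntegral`). It is close in `L¹(|m|)` to a continuous function of
norm at most `1` (`exists_continuousMap_norm_le_one_lintegral_sub_le`), on which `Φ(m)` is then
nearly `|m|(T)`. Injectivity follows.

*Surjectivity.* The modulus `g ↦ sup {|y(h)| : ‖h‖ ≤ g}` of a functional `y` is additive and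
homogeneous on nonnegative functions, so by the scalar Riesz–Markov–Kakutani theorem it is
integration against a finite measure `μ`, and `|y(h)| ≤ ∫ ‖h‖ dμ`
(`exists_measure_norm_le_integral`). Since `X` is a Hilbert space, no Radon–Nikodym theorem for
vector measures is needed: by Cauchy–Schwarz `y` extends to the Hilbert space `L²(μ, X)`, and the
Riesz–Fréchet theorem yields `g` with `y(h) = ∫ (h, g) dμ` (`exists_memLp_eq_integral_inner`). The
measure `A ↦ ∫_A g dμ` is a preimage of `y`.

*Change of variable.* As `Φ(m)(f)` is the sesquilinear integral `∫ f dm`, the formula is the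
identity `Φ(ℋ(ν)) = H_C'(Φ(ν))`, evaluated at `f`.
-/

namespace VectorMeasureOperator

/-! ### The modulus of a functional on `C(T, X)` -/

section Modulus

variable {K T X : Type*} [RCLike K] [TopologicalSpace T] [CompactSpace T]
  [NormedAddCommGroup X] [NormedSpace K X]

/-- The modulus `|y|` of a functional `y` on `C(T, X)`, evaluated at a nonnegative function `g`:
the supremum of `|y(h)|` over all `h` with `‖h(t)‖ ≤ g(t)` for every `t`. -/
noncomputable def modulus (y : C(T, X) →L[K] K) (g : C(T, ℝ≥0)) : ℝ≥0 :=
  ⨆ h : {h : C(T, X) // ∀ t, ‖h t‖₊ ≤ g t}, ‖y h‖₊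

lemma bddAbove_modulus (y : C(T, X) →L[K] K) (g : C(T, ℝ≥0)) :
    BddAbove (range fun h : {h : C(T, X) // ∀ t, ‖h t‖₊ ≤ g t} => ‖y h‖₊) := by
  obtain ⟨C, hC⟩ := (isCompact_range g.continuous).bddAbove
  refine ⟨‖y‖₊ * C, ?_⟩
  rintro _ ⟨⟨h, hh⟩, rfl⟩
  refine (y.le_opNNNorm h).trans (mul_le_mul_right ?_ _)
  exact (ContinuousMap.norm_le _ C.2).2 fun t => (hh t).trans (hC (mem_range_self t))

lemma nnnorm_le_modulus (y : C(T, X) →L[K] K) {g : C(T, ℝ≥0)} {h : C(T, X)}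
    (hh : ∀ t, ‖h t‖₊ ≤ g t) : ‖y h‖₊ ≤ modulus y g :=
  le_ciSup (bddAbove_modulus y g) ⟨h, hh⟩

lemma modulus_le (y : C(T, X) →L[K] K) {g : C(T, ℝ≥0)} {c : ℝ≥0}
    (hc : ∀ h : C(T, X), (∀ t, ‖h t‖₊ ≤ g t) → ‖y h‖₊ ≤ c) : modulus y g ≤ c :=
  have : Nonempty {h : C(T, X) // ∀ t, ‖h t‖₊ ≤ g t} := ⟨⟨0, fun t => by simp⟩⟩
  ciSup_le fun h => hc h.1 h.2

lemma modulus_smul (y : C(T, X) →L[K] K) (c : ℝ≥0) (g : C(T, ℝ≥0)) :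
    modulus y (c • g) = c * modulus y g := by
  have key : ∀ (c : ℝ≥0) (g : C(T, ℝ≥0)), c ≠ 0 → modulus y (c • g) ≤ c * modulus y g := by
    intro c g hc
    refine modulus_le y fun h hh => ?_
    have hn : ‖(((c⁻¹ : ℝ≥0) : ℝ) : K)‖₊ = c⁻¹ := by
      ext
      rw [coe_nnnorm, RCLike.norm_ofReal, NNReal.abs_eq]
    have h1 := nnnorm_le_modulus y (g := g) (h := (((c⁻¹ : ℝ≥0) : ℝ) : K) • h) fun t => by
      rw [ContinuousMap.smul_apply, nnnorm_smul, hn]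
      calc c⁻¹ * ‖h t‖₊ ≤ c⁻¹ * (c * g t) := by gcongr; exact hh t
        _ = g t := by rw [← mul_assoc, inv_mul_cancel₀ hc, one_mul]
    rw [map_smul, nnnorm_smul, hn] at h1
    calc ‖y h‖₊ = c * (c⁻¹ * ‖y h‖₊) := by rw [← mul_assoc, mul_inv_cancel₀ hc, one_mul]
      _ ≤ c * modulus y g := by gcongr
  rcases eq_or_ne c 0 with rfl | hc
  · refine le_antisymm (modulus_le y fun h hh => ?_) (by simp)
    have : h = 0 := by
      ext t
      simpa using hh t
    simp [this]
  · refine le_antisymm (key c g hc) ?_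
    have h1 := key c⁻¹ (c • g) (inv_ne_zero hc)
    rw [smul_smul, inv_mul_cancel₀ hc, one_smul] at h1
    calc c * modulus y g ≤ c * (c⁻¹ * modulus y (c • g)) := by gcongr
      _ = modulus y (c • g) := by rw [← mul_assoc, mul_inv_cancel₀ hc, one_mul]

/-- Superadditivity rotates the values of `y` to the positive half-axis; subadditivity splits
`h` with `‖h‖ ≤ g₁ + g₂` proportionally to `g₁` and `g₂`. -/
lemma modulus_add (y : C(T, X) →L[K] K) (g₁ g₂ : C(T, ℝ≥0)) :
    modulus y (g₁ + g₂) = modulus y g₁ + modulus y g₂ := by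
  apply le_antisymm
  · refine modulus_le y fun h hh => ?_
    -- The term `ε` keeps the denominator away from `0`, where the quotients would not be continuous.
    have key : ∀ ε : ℝ≥0, 0 < ε → ‖y h‖₊ ≤ modulus y g₁ + modulus y g₂ + ‖y‖₊ * ε := by
      intro ε hε
      have hpos : ∀ t, 0 < g₁ t + g₂ t + ε := fun t => by positivity
      let part : C(T, ℝ≥0) → C(T, X) := fun k =>
        ⟨fun t => ((((k t / (g₁ t + g₂ t + ε) : ℝ≥0) : ℝ)) : K) • h t, by
          have : Continuous fun t => k t / (g₁ t + g₂ t + ε) :=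
            k.continuous.div (by fun_prop) fun t => (hpos t).ne'
          exact (RCLike.continuous_ofReal.comp (NNReal.continuous_coe.comp this)).smul
            h.continuous⟩
      have hpart : ∀ k t, ‖part k t‖₊ ≤ k t := by
        intro k t
        have h1 : ‖part k t‖₊ = k t / (g₁ t + g₂ t + ε) * ‖h t‖₊ := by
          ext
          rw [coe_nnnorm, ContinuousMap.coe_mk, norm_smul, RCLike.norm_ofReal, NNReal.abs_eq]
          rfl
        rw [h1, div_mul_eq_mul_div, div_le_iff₀ (hpos t)]
        gcongr
        exact (hh t).trans (by simp)
      have hsum : h = part g₁ + part g₂ + part (.const T ε) := by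
        ext t
        simp only [part, ContinuousMap.add_apply, ContinuousMap.coe_mk, ContinuousMap.const_apply,
          ← add_smul, ← RCLike.ofReal_add, ← NNReal.coe_add, ← add_div]
        rw [div_self (hpos t).ne']
        simp
      calc ‖y h‖₊ = ‖y (part g₁) + y (part g₂) + y (part (.const T ε))‖₊ := by
            rw [← map_add, ← map_add, ← hsum]
        _ ≤ ‖y (part g₁)‖₊ + ‖y (part g₂)‖₊ + ‖y (part (.const T ε))‖₊ :=
            (nnnorm_add_le _ _).trans (by gcongr; exact nnnorm_add_le _ _)
        _ ≤ _ := by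
            gcongr
            · exact nnnorm_le_modulus y (hpart _)
            · exact nnnorm_le_modulus y (hpart _)
            · refine (y.le_opNNNorm _).trans (mul_le_mul_right ?_ _)
              exact (ContinuousMap.norm_le _ ε.2).2 (hpart (.const T ε))
    have hlim : Tendsto (fun ε : ℝ≥0 => modulus y g₁ + modulus y g₂ + ‖y‖₊ * ε) (𝓝[>] 0)
        (𝓝 (modulus y g₁ + modulus y g₂ + ‖y‖₊ * 0)) :=
      (Continuous.tendsto (by fun_prop) 0).mono_left nhdsWithin_le_nhds
    rw [mul_zero, add_zero] at hlim
    exact ge_of_tendsto hlim (eventually_mem_nhdsWithin.mono key)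
  · have key : ∀ h₁ h₂ : C(T, X), (∀ t, ‖h₁ t‖₊ ≤ g₁ t) → (∀ t, ‖h₂ t‖₊ ≤ g₂ t) →
        ‖y h₁‖₊ + ‖y h₂‖₊ ≤ modulus y (g₁ + g₂) := by
      intro h₁ h₂ hh₁ hh₂
      obtain ⟨c₁, hc₁, e₁⟩ := RCLike.exists_norm_eq_mul_self (y h₁)
      obtain ⟨c₂, hc₂, e₂⟩ := RCLike.exists_norm_eq_mul_self (y h₂)
      have h3 := nnnorm_le_modulus y (g := g₁ + g₂) (h := c₁ • h₁ + c₂ • h₂) fun t => by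
        refine (nnnorm_add_le _ _).trans (add_le_add ?_ ?_)
        · rw [ContinuousMap.smul_apply, nnnorm_smul, show ‖c₁‖₊ = 1 from NNReal.eq hc₁, one_mul]
          exact hh₁ t
        · rw [ContinuousMap.smul_apply, nnnorm_smul, show ‖c₂‖₊ = 1 from NNReal.eq hc₂, one_mul]
          exact hh₂ t
      refine le_trans (le_of_eq ?_) h3
      rw [map_add, map_smul, map_smul, smul_eq_mul, smul_eq_mul, ← e₁, ← e₂, ← RCLike.ofReal_add]
      ext
      rw [coe_nnnorm, RCLike.norm_ofReal, abs_of_nonneg (by positivity)]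
      rfl
    have key' : ∀ h₂ : C(T, X), (∀ t, ‖h₂ t‖₊ ≤ g₂ t) →
        modulus y g₁ + ‖y h₂‖₊ ≤ modulus y (g₁ + g₂) := fun h₂ hh₂ =>
      (le_tsub_iff_right (le_add_self.trans (key 0 h₂ (fun t => by simp) hh₂))).1
        (modulus_le y fun h₁ hh₁ => le_tsub_of_add_le_right (key h₁ h₂ hh₁ hh₂))
    exact (le_tsub_iff_left (le_self_add.trans (key' 0 fun t => by simp))).1
      (modulus_le y fun h₂ hh₂ => le_tsub_of_add_le_left (key' h₂ hh₂))

end Modulus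

/-! ### Domination by a measure and representation by a density -/

section Representation

variable {K T X : Type*} [RCLike K] [MetricSpace T] [CompactSpace T] [MeasurableSpace T]
  [BorelSpace T]

/-- The measure is the one that represents the modulus of `y` by the
Riesz–Markov–Kakutani theorem. -/
lemma exists_measure_norm_le_integral [NormedAddCommGroup X] [NormedSpace K X]
    (y : C(T, X) →L[K] K) :
    ∃ μ : Measure T, IsFiniteMeasure μ ∧ ∀ h : C(T, X), ‖y h‖ ≤ ∫ t, ‖h t‖ ∂μ := by
  let Λ : CompactlySupportedContinuousMap T ℝ≥0 →ₗ[ℝ≥0] ℝ≥0 :=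
    { toFun := fun g => modulus y g.toContinuousMap
      map_add' := fun g₁ g₂ => modulus_add y g₁.toContinuousMap g₂.toContinuousMap
      map_smul' := fun c g => modulus_smul y c g.toContinuousMap }
  refine ⟨NNRealRMK.rieszMeasure Λ, inferInstance, fun h => ?_⟩
  let g : CompactlySupportedContinuousMap T ℝ≥0 :=
    ⟨⟨fun t => ‖h t‖₊, by fun_prop⟩, HasCompactSupport.of_compactSpace _⟩
  have h1 := NNRealRMK.integral_rieszMeasure Λ g
  have h2 : ‖y h‖₊ ≤ Λ g := nnnorm_le_modulus y fun t => le_rfl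
  calc ‖y h‖ ≤ Λ g := h2
    _ = _ := h1.symm

/-- A functional on `C(T, X)` dominated by `h ↦ ∫ ‖h‖ dμ` extends to `L²(μ, X)`, where the
Riesz–Fréchet theorem provides its density. -/
lemma exists_memLp_eq_integral_inner [NormedAddCommGroup X] [InnerProductSpace K X]
    [CompleteSpace X] (μ : Measure T) [IsFiniteMeasure μ] (y : C(T, X) →L[K] K)
    (hy : ∀ h : C(T, X), ‖y h‖ ≤ ∫ t, ‖h t‖ ∂μ) :
    ∃ g : T → X, MemLp g 2 μ ∧ ∀ h : C(T, X), y h = ∫ t, inner K (g t) (h t) ∂μ := by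
  let _ : NormedSpace ℝ X := NormedSpace.restrictScalars ℝ K X
  let e : C(T, X) →L[K] Lp X 2 μ := ContinuousMap.toLp 2 μ K
  have he : DenseRange e := ContinuousMap.toLp_denseRange X μ K (by simp)
  have hae : ∀ h : C(T, X), e h =ᵐ[μ] h := fun h => ContinuousMap.coeFn_toLp μ h
  -- Cauchy–Schwarz on the finite measure space `(T, μ)`.
  have hbound : ∀ h : C(T, X), ‖y h‖ ≤ (μ univ ^ (1 / 2 : ℝ)).toReal * ‖e h‖ := by
    intro h
    have h1 := eLpNorm_le_eLpNorm_mul_rpow_measure_univ (μ := μ) (one_le_two (α := ℝ≥0∞))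
      h.continuous.aestronglyMeasurable
    have hexp : 1 / (1 : ℝ≥0∞).toReal - 1 / (2 : ℝ≥0∞).toReal = 1 / 2 := by norm_num
    rw [hexp, eLpNorm_one_eq_lintegral_enorm, ← eLpNorm_congr_ae (hae h)] at h1
    rw [Lp.norm_def, mul_comm, ← ENNReal.toReal_mul]
    refine ((hy h).trans_eq ?_).trans (ENNReal.toReal_mono ?_ h1)
    · exact integral_norm_eq_lintegral_enorm h.continuous.aestronglyMeasurable
    · exact ENNReal.mul_ne_top (Lp.eLpNorm_ne_top _)
        (ENNReal.rpow_ne_top_of_nonneg (by norm_num) (measure_ne_top μ _))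
  let z : Lp X 2 μ →L[K] K := y.toLinearMap.extendOfNorm e.toLinearMap
  have hz : ∀ h, z (e h) = y h := LinearMap.extendOfNorm_eq he ⟨_, hbound⟩
  let G : Lp X 2 μ := (InnerProductSpace.toDual K _).symm z
  refine ⟨G, Lp.memLp G, fun h => ?_⟩
  rw [← hz, ← InnerProductSpace.toDual_symm_apply, L2.inner_def]
  refine integral_congr_ae ?_
  filter_upwards [hae h] with t ht
  rw [ht]

end Representation

/-! ### Estimates by the variation measure -/

section Estimates

variable {K T X Y : Type*} [RCLike K] [NormedAddCommGroup X] [NormedAddCommGroup Y]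
  {p : X → Y → K}

lemma IsPairing.zero_left (hp : IsPairing p) (y : Y) : p 0 y = 0 :=
  norm_le_zero_iff.1 (by simpa using hp.bound 0 y)

lemma IsPairing.zero_right (hp : IsPairing p) (x : X) : p x 0 = 0 :=
  norm_le_zero_iff.1 (by simpa using hp.bound x 0)

lemma simpleIntegral_zero [MeasurableSpace T] (hp : IsPairing p) (ν : VectorMeasure T Y) :
    simpleIntegral p (0 : SimpleFunc T X) ν = 0 := by
  refine Finset.sum_eq_zero fun x hx => ?_
  obtain ⟨t, rfl⟩ := SimpleFunc.mem_range.1 hx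
  exact hp.zero_left _

lemma simpleIntegral_piecewise_zero [MeasurableSpace T] (hp : IsPairing p) {A : Set T}
    (hA : MeasurableSet A) (x : X) (ν : VectorMeasure T Y) :
    simpleIntegral p (SimpleFunc.piecewise A hA (.const T x) 0) ν = p x (ν A) := by
  classical
  set s := SimpleFunc.piecewise A hA (.const T x) 0
  have hs : ∀ t, s t = if t ∈ A then x else 0 := fun t => rfl
  rw [simpleIntegral, Finset.sum_eq_single x]
  · rcases eq_or_ne x 0 with rfl | hx
    · rw [hp.zero_left, hp.zero_left]
    · congr 2
      ext t
      simp [hs, hx.symm]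
  · intro z hz hzx
    obtain ⟨t, rfl⟩ := SimpleFunc.mem_range.1 hz
    rw [hs] at hzx ⊢
    rw [if_neg fun h => hzx (if_pos h), hp.zero_left]
  · intro hx
    have : s ⁻¹' {x} = ∅ := by
      ext t
      simpa using fun h => hx (SimpleFunc.mem_range.2 ⟨t, h⟩)
    rw [this, VectorMeasure.empty, hp.zero_right]

lemma enorm_simpleIntegral_le [MeasurableSpace T] (hp : IsPairing p) (s : SimpleFunc T X)
    (ν : VectorMeasure T Y) :
    ‖simpleIntegral p s ν‖ₑ ≤ ∫⁻ t, ‖s t‖ₑ ∂ν.variation := by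
  have h1 : ∫⁻ t, ‖s t‖ₑ ∂ν.variation = ∑ x ∈ s.range, ‖x‖ₑ * ν.variation (s ⁻¹' {x}) := by
    rw [← SimpleFunc.map_lintegral, ← SimpleFunc.lintegral_eq_lintegral]
    rfl
  rw [h1]
  refine (enorm_sum_le _ _).trans (Finset.sum_le_sum fun x _ => ?_)
  have h2 : ‖p x (ν (s ⁻¹' {x}))‖ₑ ≤ ‖x‖ₑ * ‖ν (s ⁻¹' {x})‖ₑ := by
    simp only [enorm_eq_nnnorm]
    exact_mod_cast hp.bound _ _
  refine h2.trans ?_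
  gcongr
  exact ν.enorm_measure_le_variation _

lemma simpleIntegral_sub [MeasurableSpace T] (hp : IsPairing p) (s s' : SimpleFunc T X)
    (ν : VectorMeasure T Y) :
    simpleIntegral p (s - s') ν = simpleIntegral p s ν - simpleIntegral p s' ν := by
  rw [eq_sub_iff_add_eq, ← simpleIntegral_add hp, sub_add_cancel]

lemma IsUniformIntegral.enorm_simpleIntegral_sub_le [MeasurableSpace T] (hp : IsPairing p)
    {f : T → X} {ν : VectorMeasure T Y} {I : K} (hI : IsUniformIntegral p f ν I)
    (hν : ν.variation univ < ∞) (s : SimpleFunc T X) :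
    ‖simpleIntegral p s ν - I‖ₑ ≤ ∫⁻ t, ‖s t - f t‖ₑ ∂ν.variation := by
  obtain ⟨u, hu⟩ := hI.1
  have key : ∀ ε : ℝ≥0, 0 < ε → ‖simpleIntegral p s ν - I‖ₑ ≤
      ∫⁻ t, ‖s t - f t‖ₑ ∂ν.variation + ε * ν.variation univ := by
    intro ε hε
    have hlim := (tendsto_const_nhds (x := simpleIntegral p s ν)).sub (hI.2 u hu)
    refine le_of_tendsto hlim.enorm ?_
    filter_upwards [Metric.tendstoUniformly_iff.1 hu ε hε] with n hn
    rw [← simpleIntegral_sub hp]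
    refine (enorm_simpleIntegral_le hp _ ν).trans ?_
    rw [← lintegral_const, ← lintegral_add_right _ measurable_const]
    refine lintegral_mono fun t => ?_
    calc ‖(s - u n) t‖ₑ = ‖(s t - f t) + (f t - u n t)‖ₑ := by
          rw [SimpleFunc.coe_sub, Pi.sub_apply, sub_add_sub_cancel]
      _ ≤ ‖s t - f t‖ₑ + ‖f t - u n t‖ₑ := enorm_add_le _ _
      _ ≤ ‖s t - f t‖ₑ + ε := by
          gcongr
          rw [enorm_eq_nnnorm, ENNReal.coe_le_coe]
          have := hn t
          rw [dist_eq_norm] at this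
          exact this.le
  have hlim : Tendsto (fun ε : ℝ≥0 => ∫⁻ t, ‖s t - f t‖ₑ ∂ν.variation + ε * ν.variation univ)
      (𝓝[>] 0) (𝓝 (∫⁻ t, ‖s t - f t‖ₑ ∂ν.variation + (0 : ℝ≥0) * ν.variation univ)) := by
    refine tendsto_const_nhds.add (ENNReal.Tendsto.mul_const ?_ (Or.inr hν.ne))
    exact ENNReal.tendsto_coe.2 nhdsWithin_le_nhds
  rw [ENNReal.coe_zero, zero_mul, add_zero] at hlim
  exact ge_of_tendsto hlim (eventually_mem_nhdsWithin.mono key)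

end Estimates

/-! ### Approximation by continuous functions of the unit ball -/

section Approximation

variable {T X : Type*} [TopologicalSpace T] [CompactSpace T] [NormalSpace T] [MeasurableSpace T]
  [BorelSpace T] [NormedAddCommGroup X] [NormedSpace ℝ X]

/-- An approximation in `L¹` is moved into the unit ball by the radial retraction, which at most
doubles the distance to points of the ball. -/
lemma exists_continuousMap_norm_le_one_lintegral_sub_le (μ : Measure T) [IsFiniteMeasure μ]
    [μ.WeaklyRegular] {f : T → X} (hf : AEStronglyMeasurable f μ) (hf1 : ∀ t, ‖f t‖ ≤ 1)
    {ε : ℝ≥0∞} (hε : ε ≠ 0) :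
    ∃ g : C(T, X), ‖g‖ ≤ 1 ∧ ∫⁻ t, ‖f t - g t‖ₑ ∂μ ≤ 2 * ε := by
  have hfL : MemLp f 1 μ := (MemLp.of_bound hf 1 (Eventually.of_forall hf1))
  obtain ⟨g, hg, -⟩ := hfL.exists_boundedContinuous_eLpNorm_sub_le (by simp) hε
  have hpos : ∀ t, 0 < max 1 ‖g t‖ := fun t => lt_max_of_lt_left one_pos
  let r : C(T, X) := ⟨fun t => (max 1 ‖g t‖)⁻¹ • g t,
    ((continuous_const.max g.continuous.norm).inv₀ fun t => (hpos t).ne').smul g.continuous⟩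
  refine ⟨r, (ContinuousMap.norm_le _ zero_le_one).2 fun t => ?_, ?_⟩
  · change ‖(max 1 ‖g t‖)⁻¹ • g t‖ ≤ 1
    rw [norm_smul, norm_inv, Real.norm_of_nonneg (hpos t).le, inv_mul_le_iff₀ (hpos t), mul_one]
    exact le_max_right _ _
  · have hr : ∀ t, ‖f t - r t‖ ≤ 2 * ‖f t - g t‖ := by
      intro t
      have h1 : ‖g t - r t‖ ≤ max 1 ‖g t‖ - 1 := by
        have e : g t - r t = (1 - (max 1 ‖g t‖)⁻¹) • g t := by
          rw [sub_smul, one_smul]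
          rfl
        have h0 : 0 ≤ 1 - (max 1 ‖g t‖)⁻¹ := sub_nonneg.2 (inv_le_one_of_one_le₀ (le_max_left _ _))
        rw [e, norm_smul, Real.norm_of_nonneg h0]
        refine (mul_le_mul_of_nonneg_left (le_max_right 1 _) h0).trans (le_of_eq ?_)
        rw [sub_mul, inv_mul_cancel₀ (hpos t).ne', one_mul]
      have h2 : max 1 ‖g t‖ - 1 ≤ ‖f t - g t‖ := by
        rcases max_cases 1 ‖g t‖ with ⟨h, -⟩ | ⟨h, -⟩ <;> rw [h]
        · simp
        · linarith [norm_sub_norm_le (g t) (f t), norm_sub_rev (g t) (f t), hf1 t]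
      linarith [norm_sub_le_norm_sub_add_norm_sub (f t) (g t) (r t)]
    rw [eLpNorm_one_eq_lintegral_enorm] at hg
    calc ∫⁻ t, ‖f t - r t‖ₑ ∂μ ≤ ∫⁻ t, 2 * ‖f t - g t‖ₑ ∂μ := by
          refine lintegral_mono fun t => ?_
          simp only [enorm_eq_nnnorm]
          exact_mod_cast hr t
      _ = 2 * ∫⁻ t, ‖f t - g t‖ₑ ∂μ := lintegral_const_mul' _ _ (by simp)
      _ ≤ 2 * ε := by
          gcongr
          exact hg

end Approximation

/-! ### Simple functions that nearly attain the variation -/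

section NearlyAttained

variable {K T X : Type*} [RCLike K] [MeasurableSpace T] [NormedAddCommGroup X]
  [InnerProductSpace K X] [CompleteSpace X]

/-- Unit vectors `xᵢ` in the directions of the values `ν(Aᵢ)` on a partition turn
`∑ᵢ ‖ν(Aᵢ)‖` into the integral of a simple function of norm at most `1`. -/
lemma exists_simpleFunc_lt_enorm_simpleIntegral (ν : VectorMeasure T X) {a : ℝ≥0∞}
    (ha : a < ν.variation univ) :
    ∃ s : SimpleFunc T X, (∀ t, ‖s t‖ ≤ 1) ∧
      a < ‖simpleIntegral (fun x y => inner K y x) s ν‖ₑ := by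
  classical
  obtain ⟨P, -, hdisj, hmeas, hP⟩ := ν.exists_lt_sum_of_lt_variation MeasurableSet.univ ha
  let c : Set T → X := fun A => ((‖ν A‖⁻¹ : ℝ) : K) • ν A
  have hc : ∀ A, ‖c A‖ ≤ 1 := by
    intro A
    rw [norm_smul, RCLike.norm_ofReal, abs_inv, abs_norm]
    exact inv_mul_le_one
  have hinner : ∀ A, inner K (ν A) (c A) = (‖ν A‖ : K) := by
    intro A
    rw [inner_smul_right, inner_self_eq_norm_sq_to_K]
    rcases eq_or_ne ‖ν A‖ 0 with h | h
    · simp [h]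
    · rw [sq, ← mul_assoc, ← RCLike.ofReal_mul, inv_mul_cancel₀ h, RCLike.ofReal_one, one_mul]
  have key : ∀ Q : Finset (Set T), Q ⊆ P → ∃ s : SimpleFunc T X,
      (∀ t, s t = ∑ A ∈ Q, A.indicator (fun _ => c A) t) ∧
      simpleIntegral (fun x y => inner K y x) s ν = ((∑ A ∈ Q, ‖ν A‖ : ℝ) : K) := by
    intro Q
    induction Q using Finset.induction_on with
    | empty => exact fun _ => ⟨0, by simp, by
      simp [simpleIntegral_zero isPairing_inner]⟩
    | insert A Q hA ih =>
      intro hQ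
      obtain ⟨hAP, hQP⟩ := Finset.insert_subset_iff.1 hQ
      obtain ⟨s, hs, hI⟩ := ih hQP
      refine ⟨SimpleFunc.piecewise A (hmeas A hAP) (.const T (c A)) 0 + s, fun t => ?_, ?_⟩
      · rw [Finset.sum_insert hA, ← hs]
        simp [Set.indicator]
      · rw [simpleIntegral_add isPairing_inner, simpleIntegral_piecewise_zero isPairing_inner,
          hI, hinner, Finset.sum_insert hA, RCLike.ofReal_add]
  obtain ⟨s, hs, hI⟩ := key P subset_rfl
  refine ⟨s, fun t => ?_, ?_⟩
  · rw [hs]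
    by_cases ht : ∃ A ∈ P, t ∈ A
    · obtain ⟨A, hA, htA⟩ := ht
      rw [Finset.sum_eq_single A, Set.indicator_of_mem htA]
      · exact hc A
      · intro B hB hBA
        exact Set.indicator_of_notMem
          (Set.disjoint_left.1 (hdisj hA hB hBA.symm) htA) _
      · exact fun h => (h hA).elim
    · rw [Finset.sum_eq_zero fun A hA => Set.indicator_of_notMem (fun h => ht ⟨A, hA, h⟩) _]
      simp
  · refine hP.trans_eq ?_
    rw [hI]
    have h0 : 0 ≤ ∑ A ∈ P, ‖ν A‖ := Finset.sum_nonneg fun _ _ => norm_nonneg _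
    rw [← ofReal_norm, RCLike.norm_ofReal, abs_of_nonneg h0,
      ENNReal.ofReal_sum_of_nonneg fun _ _ => norm_nonneg _]
    simp only [ofReal_norm]

end NearlyAttained

/-! ### The dual of `C(T, X)` -/

section Riesz

variable {K T X : Type*} [RCLike K] [MetricSpace T] [CompactSpace T] [MeasurableSpace T]
  [BorelSpace T] [NormedAddCommGroup X] [InnerProductSpace K X] [CompleteSpace X]

/-- `Φ(m)` is the sesquilinear uniform integral against `m`: since `P(y)(x)` is `(x, y)` by
definition, both sides integrate simple functions in the same way. -/
lemma Phi_apply (m : cabv K T X) (f : C(T, X)) : Phi m f = sesqIntegral K f m.1 := rfl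

lemma isUniformIntegral_Phi (m : cabv K T X) (f : C(T, X)) :
    IsUniformIntegral (fun x y => inner K y x) f m.1 (Phi m f) :=
  isUniformIntegral_uniformIntegral isPairing_apply f.continuous (Omega m).1 (Omega m).2

/-- The bound from below tests `Φ(m)` on continuous functions of norm at most `1` that are close
in `L¹(|m|)` to a simple function whose integral is close to `|m|(T)`. -/
lemma norm_Phi (m : cabv K T X) : ‖Phi m‖ = varNorm m.1 := by
  let _ : NormedSpace ℝ X := NormedSpace.restrictScalars ℝ K X
  have hm : m.1.variation univ < ∞ := m.2
  have : IsFiniteMeasure m.1.variation := ⟨hm⟩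
  apply le_antisymm
  · refine (Phi m).opNorm_le_bound ENNReal.toReal_nonneg fun f => ?_
    have h := (isUniformIntegral_Phi m f).enorm_simpleIntegral_sub_le isPairing_inner hm 0
    simp only [simpleIntegral_zero isPairing_inner, SimpleFunc.coe_zero, Pi.zero_apply, zero_sub,
      enorm_neg] at h
    have h1 : ∫⁻ t, ‖f t‖ₑ ∂m.1.variation ≤ m.1.variation univ * ‖f‖ₑ := by
      rw [mul_comm, ← lintegral_const]
      refine lintegral_mono fun t => ?_
      simp only [enorm_eq_nnnorm]
      exact_mod_cast f.norm_coe_le_norm t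
    have h2 := ENNReal.toReal_mono (ENNReal.mul_ne_top hm.ne enorm_ne_top) (h.trans h1)
    rwa [ENNReal.toReal_mul, toReal_enorm, toReal_enorm] at h2
  · refine ENNReal.toReal_le_of_le_ofReal (norm_nonneg _) (le_of_forall_lt fun a ha => ?_)
    obtain ⟨s, hs, has⟩ := exists_simpleFunc_lt_enorm_simpleIntegral (K := K) m.1 ha
    refine has.trans_le ?_
    have key : ∀ ε : ℝ≥0, 0 < ε →
        ‖simpleIntegral (fun x y => inner K y x) s m.1‖ₑ ≤ ENNReal.ofReal ‖Phi m‖ + 2 * ε := by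
      intro ε hε
      obtain ⟨f, hf, hsf⟩ := exists_continuousMap_norm_le_one_lintegral_sub_le m.1.variation
        s.stronglyMeasurable.aestronglyMeasurable hs (ENNReal.coe_ne_zero.2 hε.ne')
      have h1 := (isUniformIntegral_Phi m f).enorm_simpleIntegral_sub_le isPairing_inner hm s
      calc _ = ‖Phi m f + (simpleIntegral (fun x y => inner K y x) s m.1 - Phi m f)‖ₑ := by
            rw [add_sub_cancel]
        _ ≤ ‖Phi m f‖ₑ + ‖simpleIntegral (fun x y => inner K y x) s m.1 - Phi m f‖ₑ :=
            enorm_add_le _ _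
        _ ≤ _ := by
            gcongr
            · rw [← ofReal_norm]
              exact ENNReal.ofReal_le_ofReal ((Phi m).unit_le_opNorm f hf)
            · exact h1.trans hsf
    have hlim : Tendsto (fun ε : ℝ≥0 => ENNReal.ofReal ‖Phi m‖ + 2 * (ε : ℝ≥0∞)) (𝓝[>] 0)
        (𝓝 (ENNReal.ofReal ‖Phi m‖ + 2 * (0 : ℝ≥0))) :=
      tendsto_const_nhds.add (ENNReal.Tendsto.const_mul
        (ENNReal.tendsto_coe.2 nhdsWithin_le_nhds) (Or.inr (by simp)))
    rw [ENNReal.coe_zero, mul_zero, add_zero] at hlim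
    exact ge_of_tendsto hlim (eventually_mem_nhdsWithin.mono key)

lemma Phi_add (m₁ m₂ : cabv K T X) : Phi (m₁ + m₂) = Phi m₁ + Phi m₂ := by
  ext f
  obtain ⟨s, hs⟩ := (isUniformIntegral_Phi m₁ f).1
  refine tendsto_nhds_unique ((isUniformIntegral_Phi (m₁ + m₂) f).2 s hs) ?_
  refine (((isUniformIntegral_Phi m₁ f).2 s hs).add
    ((isUniformIntegral_Phi m₂ f).2 s hs)).congr fun n => ?_
  simp only [simpleIntegral, ← Finset.sum_add_distrib, ← inner_add_left]
  rfl

lemma Phi_smul (c : K) (m : cabv K T X) : Phi (c • m) = conj c • Phi m := by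
  ext f
  obtain ⟨s, hs⟩ := (isUniformIntegral_Phi m f).1
  refine tendsto_nhds_unique ((isUniformIntegral_Phi (c • m) f).2 s hs) ?_
  refine (((isUniformIntegral_Phi m f).2 s hs).const_smul (conj c)).congr fun n => ?_
  rw [simpleIntegral, simpleIntegral, Finset.smul_sum]
  exact Finset.sum_congr rfl fun x _ => (inner_smul_left _ _ c).symm

/-- A measure with `Φ(m) = 0` has norm `0` by the isometry, hence vanishes. -/
lemma injective_Phi : Function.Injective (Phi : cabv K T X → (C(T, X) →L[K] K)) := by
  intro m₁ m₂ h
  have h1 : Phi (m₁ + (-1 : K) • m₂) = 0 := by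
    ext f
    rw [Phi_add, Phi_smul, h]
    simp
  have h2 := norm_Phi (m₁ + (-1 : K) • m₂)
  rw [h1, norm_zero, varNorm] at h2
  have h3 := ((ENNReal.toReal_eq_zero_iff _).1 h2.symm).resolve_right
    (m₁ + (-1 : K) • m₂).2.ne
  have h4 : (m₁ + (-1 : K) • m₂).1 = 0 :=
    VectorMeasure.variation_eq_zero.1 (Measure.measure_univ_eq_zero.1 h3)
  refine Subtype.ext (VectorMeasure.ext fun A _ => ?_)
  have h5 : m₁.1 A + (-1 : K) • m₂.1 A = 0 := DFunLike.congr_fun h4 A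
  rwa [neg_smul, one_smul, ← sub_eq_add_neg, sub_eq_zero] at h5

lemma simpleIntegral_withDensityᵥ (μ : Measure T) [NormedSpace ℝ X] {g : T → X}
    (hg : Integrable g μ) (s : SimpleFunc T X) :
    simpleIntegral (fun x y => inner K y x) s (μ.withDensityᵥ g)
      = ∫ t, inner K (g t) (s t) ∂μ := by
  have hint : ∀ x : X, Integrable (fun t => inner K (g t) x) μ := fun x => hg.inner_const x
  have hpt : ∀ t, inner K (g t) (s t)
      = ∑ x ∈ s.range, (s ⁻¹' {x}).indicator (fun t => inner K (g t) x) t := by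
    intro t
    rw [Finset.sum_eq_single (s t)]
    · simp
    · intro x _ hx
      simp [Set.indicator, hx.symm]
    · intro h
      exact (h (SimpleFunc.mem_range_self _ t)).elim
  simp_rw [hpt]
  rw [integral_finsetSum _ fun x _ => (hint x).indicator (s.measurableSet_fiber x)]
  refine Finset.sum_congr rfl fun x _ => ?_
  beta_reduce
  rw [integral_indicator (s.measurableSet_fiber x), withDensityᵥ_apply hg (s.measurableSet_fiber x)]
  have h := integral_inner (𝕜 := K) (hg.integrableOn (s := s ⁻¹' {x})) x
  rw [← inner_conj_symm, ← h, ← integral_conj]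
  simp only [inner_conj_symm]

lemma variation_withDensityᵥ_lt_top {Y : Type*} [NormedAddCommGroup Y] [NormedSpace ℝ Y]
    (μ : Measure T) {g : T → Y} (hg : Integrable g μ) :
    (μ.withDensityᵥ g).variation univ < ∞ := by
  have h : (μ.withDensityᵥ g).variation ≤ μ.withDensity fun t => ‖g t‖ₑ := by
    refine VectorMeasure.variation_le_of_forall_enorm_le fun A hA => ?_
    rw [withDensityᵥ_apply hg hA, withDensity_apply _ hA]
    exact enorm_integral_le_lintegral_enorm _
  refine (h univ).trans_lt ?_
  rw [withDensity_apply _ MeasurableSet.univ, setLIntegral_univ]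
  exact hg.2

/-- The preimage of `y` has the density that represents `y` on `L²(μ, X)`, where `μ` is a finite
measure dominating `y`. -/
lemma surjective_Phi : Function.Surjective (Phi : cabv K T X → (C(T, X) →L[K] K)) := by
  let _ : NormedSpace ℝ X := NormedSpace.restrictScalars ℝ K X
  intro y
  obtain ⟨μ, hμ, hy⟩ := exists_measure_norm_le_integral y
  obtain ⟨g, hg2, hg⟩ := exists_memLp_eq_integral_inner μ y hy
  have hgi : Integrable g μ := hg2.integrable one_le_two
  refine ⟨⟨μ.withDensityᵥ g, variation_withDensityᵥ_lt_top μ hgi⟩, ?_⟩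
  ext f
  obtain ⟨s, hs⟩ := exists_tendstoUniformly_simpleFunc f.continuous
  refine tendsto_nhds_unique ((isUniformIntegral_Phi _ f).2 s hs) ?_
  simp only [simpleIntegral_withDensityᵥ μ hgi, hg]
  refine tendsto_integral_filter_of_dominated_convergence (fun t => ‖g t‖ * (‖f‖ + 1)) ?_ ?_
    (hgi.norm.mul_const _) ?_
  · exact Eventually.of_forall fun n =>
      hgi.aestronglyMeasurable.inner (s n).stronglyMeasurable.aestronglyMeasurable
  · filter_upwards [Metric.tendstoUniformly_iff.1 hs 1 one_pos] with n hn
    refine Eventually.of_forall fun t => (norm_inner_le_norm _ _).trans ?_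
    gcongr
    have h1 := hn t
    rw [dist_comm, dist_eq_norm] at h1
    linarith [norm_sub_norm_le (s n t) (f t), f.norm_coe_le_norm t]
  · exact Eventually.of_forall fun t => tendsto_const_nhds.inner (hs.tendsto_at t)

end Riesz

end VectorMeasureOperator

theorem theorem4p3 {K T X Θ : Type*} [RCLike K]
    [MetricSpace T] [CompactSpace T] [MeasurableSpace T] [BorelSpace T]
    [NormedAddCommGroup X] [InnerProductSpace K X] [CompleteSpace X]
    [MeasurableSpace X] [BorelSpace X]
    [MeasurableSpace Θ] (W : Measure Θ) (S : Framework K T X W) :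
    -- `Φ` is an antilinear isometric bijection of `cabv(T, X)` onto the dual of `C(T, X)`
    (Function.Bijective (Phi : cabv K T X → (C(T, X) →L[K] K)) ∧
      (∀ m₁ m₂ : cabv K T X, Phi (m₁ + m₂) = Phi m₁ + Phi m₂) ∧
      (∀ (c : K) (m : cabv K T X), Phi (c • m) = conj c • Phi m) ∧
      (∀ m : cabv K T X, ‖Phi m‖ = varNorm (m : VectorMeasure T X))) ∧
    -- the change of variable formula
    ∀ (f : C(T, X)) (ν : cabv K T X),
      sesqIntegral K f (S.measureOp ν : VectorMeasure T X)
        = sesqIntegral K (S.HC f) (ν : VectorMeasure T X) := by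
  refine ⟨⟨⟨injective_Phi, surjective_Phi⟩, Phi_add, Phi_smul, norm_Phi⟩, fun f ν => ?_⟩
  -- Surjectivity is what makes `Function.invFun Φ` a right inverse of `Φ`.
  have h : Phi (S.measureOp ν) = S.HCadjoint (Phi ν) := Function.invFun_eq (surjective_Phi _)
  rw [← Phi_apply, ← Phi_apply, h]
  rfl
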